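/- Conventions. A problem has a nonempty set of instances and, for each instance, a nonempty set of solutions; a problem is finite if it has finitely many instances, each with finitely many solutions, and all of these are natural numbers. A natural number $n$ is identified with $\{0,\dots,n-1\}$. Finite objects (functions $m\to n$, unordered pairs) are identified with numbers by means of a standard coding; sequences of numbers are elements of $\mathbb{N}^{\mathbb{N}}$, and where a number has to be regarded as an element of $\mathbb{N}^{\mathbb{N}}$ it is represented by the constant sequence with that value. Problems. - For $k\ge 1$, $\mathsf{id}_k$ has instances $j\in\{1,\dots,k\}$, the only solution to $j$ being $j$. - For $k\ge 2$, $\mathsf{lim}_k$ has as instances the convergent sequences of numbers less than $k$, the only solution being the limit. - For $m>n\ge 2$, $\mathsf{WPHP}(m\to n)$ has as instances all functions $f:m\to n$, the solutions to $f$ being all $\{i,j\}$ with $i,j<m$, $i\ne j$ and $f(i)=f(j)$. - For $m>n\ge 2$, the jump $\mathsf{WPHP}'(m\to n)$ has as instances all pointwise convergent sequences $(f_s:m\to n)_{s\in\mathbb{N}}$, the solutions being all $\{i,j\}$ with $i,j<m$, $i\ne j$ and $\lim_s f_s(i)=\lim_s f_s(j)$. Reducibilities. For finite problems, $\mathsf{P}\le\mathsf{Q}$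 means that there are partial functions $\Phi,\Psi$ on $\mathbb{N}$ such that for every $\mathsf{P}$-instance $x$, $\Phi(x)$ is a $\mathsf{Q}$-instance, and for every $\mathsf{Q}$-solution $y$ to $\Phi(x)$, $\Psi(y)$ is a $\mathsf{P}$-solution to $x$. For problems with instances and solutions in $\mathbb{N}^{\mathbb{N}}$, $\mathsf{P}\le_{\mathrm{sW}}\mathsf{Q}$ means the same with $\Phi,\Psi$ Turing functionals (computable partial functionals on $\mathbb{N}^{\mathbb{N}}$); $\mathsf{P}\le^{*}_{\mathrm{sW}}\mathsf{Q}$ means the same with $\Phi,\Psi$ continuous partial functionals on $\mathbb{N}^{\mathbb{N}}$ (each continuous on its domain); and $\mathsf{P}\le_{\mathrm{W}}\mathsf{Q}$ means that there are Turing functionals $\Phi,\Psi$ such that for every $\mathsf{P}$-instance $p$, $\Phi(p)$ is a $\mathsf{Q}$-instance, and for every $\mathsf{Q}$-solution $q$ to $\Phi(p)$, $\Psi(p,q)$ is a $\mathsf{P}$-solution to $p$. Theorem. Let $k\ge 2$ and $m>n\ge 2$. The following are equivalent: 1. $\mathsf{lim}_k\le_{\mathrm{W}}\mathsf{WPHP}'(m\to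 n)$; 2. $\mathsf{lim}_k\le_{\mathrm{sW}}\mathsf{WPHP}'(m\to n)$; 3. $\mathsf{lim}_k\le^{*}_{\mathrm{sW}}\mathsf{WPHP}'(m\to n)$; 4. $\mathsf{id}_k\le^{*}_{\mathrm{sW}}\mathsf{WPHP}(m\to n)$; 5. $\mathsf{id}_k\le\mathsf{WPHP}(m\to n)$; 6. $\mathsf{id}_k\le_{\mathrm{sW}}\mathsf{WPHP}(m\to n)$. Moreover, for all $m_0>n_0\ge 2$ and $m_1>n_1\ge 2$, $\mathsf{WPHP}(m_0\to n_0)\le\mathsf{WPHP}(m_1\to n_1)$ if and only if $\mathsf{WPHP}'(m_0\to n_0)\le_{\mathrm{W}}\mathsf{WPHP}'(m_1\to n_1)$. -/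

import Mathlib

open Filter Topology

/-- An instance-solution problem whose instances and solutions are elements of `X`: a nonempty set
of instances and, for each instance, a nonempty set of solutions. The values of `sol` outside `dom`
are irrelevant. -/
structure Problem (X : Type) where
  dom : Set X
  sol : X → Set X
  dom_nonempty : dom.Nonempty
  sol_nonempty : ∀ x ∈ dom, (sol x).Nonempty

/-- A finite problem: finitely many instances, all of them numbers, and for each of them finitely
many solutions, all of them numbers. -/
structure FiniteProblem extends Problem ℕ where
  dom_finite : dom.Finite
  sol_finite : ∀ x ∈ dom, (sol x).Finite

/-- `P ≤ Q` for finite problems, witnessed by arbitrary partial functions on numbers. -/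
def FiniteProblem.Reducible (P Q : FiniteProblem) : Prop :=
  ∃ Φ Ψ : ℕ →. ℕ, ∀ x ∈ P.dom, ∃ x' ∈ Φ x, x' ∈ Q.dom ∧
    ∀ y ∈ Q.sol x', ∃ z ∈ Ψ y, z ∈ P.sol x

/-- The set of functions from `ℕ` to `ℕ`. Its topology is the product of the discrete
topologies. -/
abbrev Baire : Type := ℕ → ℕ

/-- The initial segment `f(0), …, f(k-1)` of `f`. -/
def initSeg (f : Baire) (k : ℕ) : List ℕ := (List.range k).map f

/-- A partial functional on Baire space is a Turing functional if there is a computable monotone map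
`F` from finite strings to finite strings such that `Φ(f) = g` exactly if the strings `F(σ)`, for
`σ` an initial segment of `f`, exhaust `g`. As `F` is monotone, each of these strings is then an
initial segment of `g`, and `g` is the only function with this property. -/
def IsTuringFunctional (Φ : Baire →. Baire) : Prop :=
  ∃ F : List ℕ → List ℕ, Computable F ∧ (∀ σ τ, σ <+: τ → F σ <+: F τ) ∧
    ∀ f g, g ∈ Φ f ↔ ∀ n, ∃ k, initSeg g n <+: F (initSeg f k)

/-- A partial functional on Baire space is continuous if it is continuous on its domain, with the
subspace topology. -/
def IsContinuousFunctional (Φ : Baire →. Baire) : Prop :=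
  Continuous Φ.asSubtype

/-- The standard pairing `p(0), q(0), p(1), q(1), …` on Baire space. -/
def Baire.join (p q : Baire) : Baire :=
  fun i => if i % 2 = 0 then p (i / 2) else q (i / 2)

namespace Problem

/-- The functionals `Φ` and `Ψ` witness a strong reduction from `P` to `Q`: here `Ψ` sees only the
solution `q`. -/
def StrongWitness (P Q : Problem Baire) (Φ Ψ : Baire →. Baire) : Prop :=
  ∀ p ∈ P.dom, ∃ p' ∈ Φ p, p' ∈ Q.dom ∧ ∀ q ∈ Q.sol p', ∃ r ∈ Ψ q, r ∈ P.sol p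

/-- The functionals `Φ` and `Ψ` witness a reduction from `P` to `Q`: here `Ψ` sees the instance `p`
and the solution `q`. -/
def Witness (P Q : Problem Baire) (Φ Ψ : Baire →. Baire) : Prop :=
  ∀ p ∈ P.dom, ∃ p' ∈ Φ p, p' ∈ Q.dom ∧ ∀ q ∈ Q.sol p', ∃ r ∈ Ψ (p.join q), r ∈ P.sol p

/-- Strong Weihrauch reducibility. -/
def SW (P Q : Problem Baire) : Prop :=
  ∃ Φ Ψ, IsTuringFunctional Φ ∧ IsTuringFunctional Ψ ∧ StrongWitness P Q Φ Ψ

/-- Strong continuous Weihrauch reducibility. -/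
def ContSW (P Q : Problem Baire) : Prop :=
  ∃ Φ Ψ, IsContinuousFunctional Φ ∧ IsContinuousFunctional Ψ ∧ StrongWitness P Q Φ Ψ

/-- Weihrauch reducibility. -/
def W (P Q : Problem Baire) : Prop :=
  ∃ Φ Ψ, IsTuringFunctional Φ ∧ IsTuringFunctional Ψ ∧ Witness P Q Φ Ψ

end Problem

/-- The number `x` as an element of Baire space: the constant sequence with value `x`. -/
def constSeq (x : ℕ) : Baire := fun _ => x

/-- A finite problem as a problem on Baire space, numbers being represented by constant
sequences. -/
def FiniteProblem.toBaire (P : FiniteProblem) : Problem Baire where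
  dom := constSeq '' P.dom
  sol p := constSeq '' P.sol (p 0)
  dom_nonempty := P.dom_nonempty.image _
  sol_nonempty := by
    rintro _ ⟨x, hx, rfl⟩
    exact (P.sol_nonempty x hx).image _

/-- The problem `id_k`: the instances are `1, …, k`, and `j` is the only solution to `j`. -/
def idProblem (k : ℕ) (hk : 1 ≤ k) : FiniteProblem where
  dom := Set.Icc 1 k
  sol j := {j}
  dom_nonempty := ⟨1, le_rfl, hk⟩
  sol_nonempty j _ := Set.singleton_nonempty j
  dom_finite := Set.finite_Icc 1 k
  sol_finite j _ := Set.finite_singleton j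

/-- The problem `lim_k`: the instances are the convergent sequences of numbers below `k`, the only
solution is the limit. -/
def limProblem (k : ℕ) (hk : 2 ≤ k) : Problem Baire where
  dom := {p | (∀ s, p s < k) ∧ ∃ l, Tendsto p atTop (𝓝 l)}
  sol p := {q | ∃ l, Tendsto p atTop (𝓝 l) ∧ q = constSeq l}
  dom_nonempty := ⟨constSeq 0, fun _ => by simp only [constSeq]; omega, 0, tendsto_const_nhds⟩
  sol_nonempty := fun _ ⟨_, l, hl⟩ => ⟨constSeq l, l, hl, rfl⟩

/-- The code of a function from `{0, …, m-1}` to `{0, …, n-1}`: the standard code of the list of its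
values. -/
def funCode {m n : ℕ} (f : Fin m → Fin n) : ℕ :=
  Encodable.encode (List.ofFn fun i => (f i : ℕ))

theorem funCode_injective {m n : ℕ} : Function.Injective (funCode (m := m) (n := n)) := by
  intro f g h
  have h' := List.ofFn_injective (Encodable.encode_injective h)
  funext i
  exact Fin.ext (congrFun h' i)

/-- The code of the unordered pair `{i, j}`. -/
def pairCode {m : ℕ} (i j : Fin m) : ℕ := Nat.pair (min i j : Fin m) (max i j : Fin m)

/-- The set of codes of the pairs `{i, j}` with `i ≠ j` and `f(i) = f(j)`. -/
def collisions {m n : ℕ} (f : Fin m → Fin n) : Set ℕ :=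
  {c | ∃ i j, i ≠ j ∧ f i = f j ∧ c = pairCode i j}

theorem collisions_nonempty {m n : ℕ} (h : n < m) (f : Fin m → Fin n) :
    (collisions f).Nonempty := by
  obtain ⟨i, j, hij, hf⟩ := Fintype.exists_ne_map_eq_of_card_lt f (by simpa using h)
  exact ⟨_, i, j, hij, hf, rfl⟩

theorem collisions_finite {m n : ℕ} (f : Fin m → Fin n) : (collisions f).Finite := by
  refine (Set.finite_range fun x : Fin m × Fin m => pairCode x.1 x.2).subset ?_
  rintro _ ⟨i, j, _, _, rfl⟩
  exact ⟨(i, j), rfl⟩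

/-- The weak pigeonhole problem: the instances are the functions from `m` to `n`, the solutions to
`f` are the pairs `{i, j}` with `i ≠ j` and `f(i) = f(j)`. -/
def wphp (m n : ℕ) (hn : 2 ≤ n) (hm : n < m) : FiniteProblem where
  dom := Set.range (funCode (m := m) (n := n))
  sol c := {d | ∃ f : Fin m → Fin n, c = funCode f ∧ d ∈ collisions f}
  dom_nonempty := ⟨_, (fun _ => ⟨0, by omega⟩), rfl⟩
  sol_nonempty := by
    rintro _ ⟨f, rfl⟩
    obtain ⟨c, hc⟩ := collisions_nonempty hm f
    exact ⟨c, f, rfl, hc⟩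
  dom_finite := Set.finite_range _
  sol_finite := by
    rintro _ ⟨f, rfl⟩
    refine (collisions_finite f).subset ?_
    rintro d ⟨g, hg, hd⟩
    rwa [funCode_injective hg]

/-- The sequence `p` of numbers codes a sequence of functions from `m` to `n` that converges
pointwise to `g`. -/
def CodesLimit {m n : ℕ} (p : Baire) (g : Fin m → Fin n) : Prop :=
  ∃ f : ℕ → Fin m → Fin n, (∀ s, p s = funCode (f s)) ∧
    ∀ i, Tendsto (fun s => f s i) atTop (𝓝 (g i))

/-- The jump of the weak pigeonhole problem: the instances are the pointwise convergent sequences of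
functions from `m` to `n`, the solutions are the pairs `{i, j}` with `i ≠ j` at which the limit
function takes the same value. -/
def wphpJump (m n : ℕ) (hn : 2 ≤ n) (hm : n < m) : Problem Baire where
  dom := {p | ∃ g : Fin m → Fin n, CodesLimit p g}
  sol p := {q | ∃ g : Fin m → Fin n, CodesLimit p g ∧ ∃ c ∈ collisions g, q = constSeq c}
  dom_nonempty := ⟨fun _ => funCode (fun _ : Fin m => (⟨0, by omega⟩ : Fin n)),
    (fun _ => ⟨0, by omega⟩), (fun _ _ => ⟨0, by omega⟩), fun _ => rfl, fun _ => tendsto_const_nhds⟩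
  sol_nonempty := by
    rintro p ⟨g, hg⟩
    obtain ⟨c, hc⟩ := collisions_nonempty hm g
    exact ⟨constSeq c, g, hg, c, hc, rfl⟩

/-! The pigeonhole principle enters only through finiteness: `lim_k` and `WPHP'` are jumps of finite
problems, and for jumps `P'`, `Q'` of finite `P`, `Q` every reducibility considered between `P'` and
`Q'` amounts to `P ≤ Q`. If `P ≤ Q`, finite tables applied termwise reduce `P'` to `Q'`, since maps
on discrete spaces preserve limits (`IsJump.sw_of_reducible`). Conversely
(`IsJump.reducible_of_witness`), `Q` has finitely many solutions, so some finite sequence of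
`P`-instances decides the backward answer on a maximal set of them. Continuing it by constant `x`
gives a `P'`-instance with limit `x`. By maximality every solution arising there is already decided,
so the answer is a function of the solution alone. -/

/-- `P'` is the jump of the finite problem `P`: its instances are the convergent sequences of
instances of `P`, the solutions are the solutions to the limit. -/
def FiniteProblem.IsJump (P : FiniteProblem) (P' : Problem Baire) : Prop :=
  (∀ p, p ∈ P'.dom ↔ (∀ s, p s ∈ P.dom) ∧ ∃ x, Tendsto p atTop (𝓝 x)) ∧
  ∀ p x, (∀ s, p s ∈ P.dom) → Tendsto p atTop (𝓝 x) → P'.sol p = constSeq '' P.sol x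

/-! ### Turing functionals and their finite use -/

theorem initSeg_prefix (f : Baire) {k l : ℕ} (h : k ≤ l) : initSeg f k <+: initSeg f l := by
  obtain ⟨d, rfl⟩ := Nat.exists_eq_add_of_le h
  rw [initSeg, initSeg, List.range_add, List.map_append]
  exact List.prefix_append _ _

theorem initSeg_length (f : Baire) (k : ℕ) : (initSeg f k).length = k := by
  simp [initSeg]

theorem initSeg_congr {f g : Baire} {k : ℕ} (h : ∀ i < k, f i = g i) :
    initSeg f k = initSeg g k :=
  List.map_congr_left fun i hi => h i (List.mem_range.1 hi)

theorem eq_of_initSeg_eq {f g : Baire} {k : ℕ} (h : initSeg f k = initSeg g k) {i : ℕ}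
    (hi : i < k) : f i = g i :=
  List.map_inj_left.1 h i (List.mem_range.2 hi)

theorem eq_of_initSeg_prefix {f g : Baire} (h : ∀ n, ∃ k, initSeg f n <+: initSeg g k) :
    f = g := by
  funext i
  obtain ⟨k, hk⟩ := h (i + 1)
  have hle : i + 1 ≤ k := by simpa [initSeg_length] using hk.length_le
  have h2 := initSeg_prefix g hle
  exact eq_of_initSeg_eq ((List.prefix_of_prefix_length_le hk h2
    (by simp [initSeg_length])).eq_of_length (by simp [initSeg_length])) i.lt_succ_self

/-- Every value of a Turing functional is determined by an initial segment of the argument. -/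
theorem IsTuringFunctional.exists_use {Φ : Baire →. Baire} (hΦ : IsTuringFunctional Φ)
    {f g : Baire} (hg : g ∈ Φ f) (n : ℕ) :
    ∃ k, ∀ f', (∀ i < k, f' i = f i) → ∀ g' ∈ Φ f', g' n = g n := by
  obtain ⟨F, -, hmono, hF⟩ := hΦ
  obtain ⟨k, hk⟩ := (hF f g).1 hg (n + 1)
  refine ⟨k, fun f' hf' g' hg' => ?_⟩
  obtain ⟨l, hl⟩ := (hF f' g').1 hg' (n + 1)
  rw [← initSeg_congr hf'] at hk
  have h1 := hk.trans (hmono _ _ (initSeg_prefix f' (le_max_left k l)))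
  have h2 := hl.trans (hmono _ _ (initSeg_prefix f' (le_max_right k l)))
  exact eq_of_initSeg_eq ((List.prefix_of_prefix_length_le h2 h1
    (by simp [initSeg_length])).eq_of_length (by simp [initSeg_length])) n.lt_succ_self

/-- By finite use, each coordinate of the value is locally constant on the domain. -/
theorem IsTuringFunctional.isContinuousFunctional {Φ : Baire →. Baire}
    (hΦ : IsTuringFunctional Φ) : IsContinuousFunctional Φ := by
  refine continuous_pi fun n => continuous_iff_continuousAt.2 fun f => ?_
  obtain ⟨k, hk⟩ := hΦ.exists_use (Part.get_mem f.2) n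
  refine tendsto_pure.2 (?_ : ∀ᶠ f' in 𝓝 f, Φ.asSubtype f' n = Φ.asSubtype f n) |>.mono_right
    (pure_le_nhds _)
  have hev : ∀ᶠ f' : Φ.Dom in 𝓝 f, ∀ i ∈ Finset.range k, f'.1 i = f.1 i := by
    rw [Filter.eventually_all_finset]
    intro i _
    have hc : Continuous fun f' : Φ.Dom => f'.1 i :=
      (continuous_apply i).comp continuous_subtype_val
    exact tendsto_pure.1 (nhds_discrete ℕ ▸ hc.tendsto f)
  filter_upwards [hev] with f' hf'
  exact hk f'.1 (fun i hi => hf' i (Finset.mem_range.2 hi)) _ (Part.get_mem f'.2)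

theorem isTuringFunctional_comp {φ : ℕ → ℕ} (hφ : Primrec φ) :
    IsTuringFunctional fun f => Part.some (φ ∘ f) := by
  have hmap : ∀ f k, (initSeg f k).map φ = initSeg (φ ∘ f) k := fun f k => by simp [initSeg]
  refine ⟨List.map φ, (Primrec.list_map Primrec.id (hφ.comp Primrec.snd).to₂).to_comp,
    fun σ τ h => h.map φ, fun f g => ?_⟩
  simp only [Part.mem_some_iff, hmap]
  exact ⟨fun h n => ⟨n, h ▸ List.prefix_rfl⟩, eq_of_initSeg_prefix⟩

/-- A Turing functional can be applied to the second component of a pair. -/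
theorem IsTuringFunctional.comp_odd {Φ : Baire →. Baire} (hΦ : IsTuringFunctional Φ) :
    IsTuringFunctional fun h => Φ fun i => h (2 * i + 1) := by
  obtain ⟨F, hF, hmono, hspec⟩ := hΦ
  -- A string of length `l` has `l / 2` odd positions, so the default `0` is never read.
  let odd : List ℕ → List ℕ := fun σ =>
    (List.range (σ.length / 2)).map fun i => σ.getD (2 * i + 1) 0
  have hodd : Primrec odd := by
    refine Primrec.list_map (Primrec.list_range.comp
      (Primrec.nat_div.comp Primrec.list_length (Primrec.const 2))) ?_
    exact ((Primrec.list_getD 0).comp Primrec.fst (Primrec.nat_add.comp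
      (Primrec.nat_mul.comp (Primrec.const 2) Primrec.snd) (Primrec.const 1))).to₂
  have hseg : ∀ h k, odd (initSeg h k) = initSeg (fun i => h (2 * i + 1)) (k / 2) := by
    intro h k
    simp only [odd, initSeg_length]
    refine List.map_congr_left fun i hi => ?_
    have : 2 * i + 1 < k := by
      have := List.mem_range.1 hi
      omega
    simp [initSeg, List.getD, this]
  refine ⟨fun σ => F (odd σ), hF.comp hodd.to_comp, fun σ τ h => hmono _ _ ?_, fun h g => ?_⟩
  · obtain ⟨ρ, rfl⟩ := h
    obtain ⟨d, hd⟩ := Nat.exists_eq_add_of_le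
      (Nat.div_le_div_right (c := 2) (show σ.length ≤ (σ ++ ρ).length by simp))
    simp only [odd]
    rw [hd, List.range_add, List.map_append]
    have heq : (List.range (σ.length / 2)).map (fun i => σ.getD (2 * i + 1) 0) =
        (List.range (σ.length / 2)).map fun i => (σ ++ ρ).getD (2 * i + 1) 0 := by
      refine List.map_congr_left fun i hi => ?_
      have : 2 * i + 1 < σ.length := by
        have := List.mem_range.1 hi
        omega
      simp [List.getD, List.getElem?_append_left this]
    exact heq ▸ List.prefix_append _ _
  · simp only [hseg]
    rw [hspec]
    refine forall_congr' fun n => ⟨?_, ?_⟩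
    · rintro ⟨k, hk⟩
      exact ⟨2 * k, by simpa using hk⟩
    · rintro ⟨k, hk⟩
      exact ⟨k / 2, hk⟩

theorem Baire.join_odd (p q : Baire) : (fun i => p.join q (2 * i + 1)) = q := by
  funext i
  have h1 : (2 * i + 1) % 2 = 1 := by omega
  have h2 : (2 * i + 1) / 2 = i := by omega
  simp [Baire.join, h1, h2]

theorem Problem.SW.w {P Q : Problem Baire} (h : P.SW Q) : P.W Q := by
  obtain ⟨Φ, Ψ, hΦ, hΨ, hw⟩ := h
  refine ⟨Φ, _, hΦ, hΨ.comp_odd, fun p hp => ?_⟩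
  obtain ⟨p', hp', hd, hs⟩ := hw p hp
  exact ⟨p', hp', hd, fun q hq => by simpa only [Baire.join_odd] using hs q hq⟩

theorem Problem.SW.contSW {P Q : Problem Baire} (h : P.SW Q) : P.ContSW Q :=
  let ⟨Φ, Ψ, hΦ, hΨ, hw⟩ := h
  ⟨Φ, Ψ, hΦ.isContinuousFunctional, hΨ.isContinuousFunctional, hw⟩

/-! ### Reductions between finite problems -/

/-- Every function agrees on a finite set with a primitive recursive one. -/
theorem exists_primrec_eqOn {S : Set ℕ} (hS : S.Finite) (g : ℕ → ℕ) :
    ∃ φ, Primrec φ ∧ ∀ x ∈ S, φ x = g x := by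
  induction S, hS using Set.Finite.induction_on with
  | empty => exact ⟨id, Primrec.id, by simp⟩
  | @insert a S _ _ ih =>
    obtain ⟨φ, hφ, h⟩ := ih
    refine ⟨fun x => if x = a then g a else φ x, Primrec.ite
      (Primrec.eq.comp Primrec.id (Primrec.const a)) (Primrec.const _) hφ, fun x hx => ?_⟩
    by_cases hxa : x = a
    · simp [hxa]
    · simp [hxa, h x (hx.resolve_left hxa)]

namespace FiniteProblem

theorem finite_solutions (P : FiniteProblem) : (⋃ x ∈ P.dom, P.sol x).Finite :=
  P.dom_finite.biUnion P.sol_finite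

/-- A reduction of finite problems is witnessed by primitive recursive functions. -/
theorem Reducible.exists_primrec {P Q : FiniteProblem} (h : P.Reducible Q) :
    ∃ φ ψ : ℕ → ℕ, Primrec φ ∧ Primrec ψ ∧
      ∀ x ∈ P.dom, φ x ∈ Q.dom ∧ ∀ y ∈ Q.sol (φ x), ψ y ∈ P.sol x := by
  classical
  obtain ⟨Φ, Ψ, h⟩ := h
  obtain ⟨φ, hφ, hφ'⟩ := exists_primrec_eqOn P.dom_finite
    fun x => if hx : (Φ x).Dom then (Φ x).get hx else 0
  obtain ⟨ψ, hψ, hψ'⟩ := exists_primrec_eqOn Q.finite_solutions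
    fun y => if hy : (Ψ y).Dom then (Ψ y).get hy else 0
  refine ⟨φ, ψ, hφ, hψ, fun x hx => ?_⟩
  obtain ⟨x', ⟨hx', rfl⟩, hd, hs⟩ := h x hx
  have he : φ x = (Φ x).get hx' := by simp [hφ' x hx, hx']
  rw [he]
  refine ⟨hd, fun y hy => ?_⟩
  obtain ⟨z, ⟨hz, rfl⟩, hzs⟩ := hs y hy
  have he' : ψ y = (Ψ y).get hz := by
    simp [hψ' y (Set.mem_biUnion hd hy), hz]
  rwa [he']

theorem reducible_of_forall {P Q : FiniteProblem} (φ ψ : ℕ → ℕ)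
    (h : ∀ x ∈ P.dom, φ x ∈ Q.dom ∧ ∀ y ∈ Q.sol (φ x), ψ y ∈ P.sol x) : P.Reducible Q :=
  ⟨φ, ψ, fun x hx => ⟨φ x, Part.mem_some _, (h x hx).1,
    fun y hy => ⟨ψ y, Part.mem_some _, (h x hx).2 y hy⟩⟩⟩

theorem Reducible.toBaire {P Q : FiniteProblem} (h : P.Reducible Q) :
    P.toBaire.SW Q.toBaire := by
  obtain ⟨φ, ψ, hφ, hψ, h⟩ := h.exists_primrec
  refine ⟨_, _, isTuringFunctional_comp hφ, isTuringFunctional_comp hψ, ?_⟩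
  rintro _ ⟨x, hx, rfl⟩
  refine ⟨_, Part.mem_some _, ⟨φ x, (h x hx).1, rfl⟩, ?_⟩
  rintro _ ⟨y, hy, rfl⟩
  exact ⟨_, Part.mem_some _, ψ y, (h x hx).2 y hy, rfl⟩

theorem reducible_of_toBaire {P Q : FiniteProblem} (h : P.toBaire.ContSW Q.toBaire) :
    P.Reducible Q := by
  obtain ⟨Φ, Ψ, -, -, h⟩ := h
  refine ⟨fun x => (Φ (constSeq x)).map (· 0), fun y => (Ψ (constSeq y)).map (· 0),
    fun x hx => ?_⟩
  obtain ⟨_, hx', ⟨x', hd, rfl⟩, hs⟩ := h _ ⟨x, hx, rfl⟩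
  refine ⟨x', Part.mem_map (· 0) hx', hd, fun y hy => ?_⟩
  obtain ⟨_, hr, z, hz, rfl⟩ := hs _ ⟨y, hy, rfl⟩
  exact ⟨z, Part.mem_map (· 0) hr, hz⟩

/-! ### Reductions between jumps -/

variable {P Q : FiniteProblem} {P' Q' : Problem Baire}

theorem mem_dom_of_tendsto {p : Baire} {x : ℕ} (hp : ∀ s, p s ∈ P.dom)
    (hx : Tendsto p atTop (𝓝 x)) : x ∈ P.dom := by
  rw [nhds_discrete, tendsto_pure] at hx
  obtain ⟨s, hs⟩ := hx.exists
  exact hs ▸ hp s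

theorem IsJump.sw_of_reducible (hP : P.IsJump P') (hQ : Q.IsJump Q') (h : P.Reducible Q) :
    P'.SW Q' := by
  obtain ⟨φ, ψ, hφ, hψ, h⟩ := h.exists_primrec
  refine ⟨_, _, isTuringFunctional_comp hφ, isTuringFunctional_comp hψ, fun p hp => ?_⟩
  obtain ⟨hp, x, hx⟩ := (hP.1 p).1 hp
  have hd := fun s => (h _ (hp s)).1
  have ht : Tendsto (φ ∘ p) atTop (𝓝 (φ x)) :=
    (continuous_of_discreteTopology.tendsto x).comp hx
  refine ⟨_, Part.mem_some _, (hQ.1 _).2 ⟨hd, _, ht⟩, fun q hq => ?_⟩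
  replace hq := (hQ.2 (φ ∘ p) _ hd ht).subset hq
  obtain ⟨y, hy, rfl⟩ := hq
  refine ⟨_, Part.mem_some _, ?_⟩
  rw [hP.2 _ _ hp hx]
  exact ⟨ψ y, (h x (mem_dom_of_tendsto hp hx)).2 y hy, rfl⟩

/-- A reduction of jumps yields a reduction of the finite problems, provided the first value of the
backward functional depends only on an initial segment of the instance. The proof fixes an initial
segment that decides this value for as many solutions as possible. -/
theorem IsJump.reducible_of_witness (hP : P.IsJump P') (hQ : Q.IsJump Q')
    (Φ : Baire →. Baire) (Ψ : Baire → Baire →. Baire)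
    (huse : ∀ p q, ∀ r ∈ Ψ p q, ∃ k, ∀ p', (∀ i < k, p' i = p i) → ∀ r' ∈ Ψ p' q, r' 0 = r 0)
    (h : ∀ p ∈ P'.dom, ∃ p' ∈ Φ p, p' ∈ Q'.dom ∧ ∀ q ∈ Q'.sol p', ∃ r ∈ Ψ p q, r ∈ P'.sol p) :
    P.Reducible Q := by
  classical
  let C : Set ℕ := ⋃ x ∈ Q.dom, Q.sol x
  let D : Baire × ℕ → Set ℕ := fun a =>
    {c ∈ C | ∃ z, ∀ p', (∀ i < a.2, p' i = a.1 i) → ∀ r ∈ Ψ p' (constSeq c), r 0 = z}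
  let A : Set (Baire × ℕ) := {a | ∀ s, a.1 s ∈ P.dom}
  obtain ⟨x₀, hx₀⟩ := P.dom_nonempty
  have hfin : (D '' A).Finite := Q.finite_solutions.finite_subsets.subset (by
    rintro _ ⟨a, -, rfl⟩
    exact fun c hc => hc.1)
  obtain ⟨_, ⟨⟨p, n⟩, hp, rfl⟩, hmax⟩ :=
    hfin.exists_maximal ⟨_, (constSeq x₀, 0), fun _ => hx₀, rfl⟩
  -- The sequence agrees with the maximal segment, yet may still converge to any instance `x`.
  let e : ℕ → Baire := fun x i => if i < n then p i else x
  have he : ∀ x ∈ P.dom, ∀ s, e x s ∈ P.dom := by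
    intro x hx s
    by_cases hs : s < n
    · simpa [e, hs] using hp s
    · simpa [e, hs] using hx
  have hlim : ∀ x, Tendsto (e x) atTop (𝓝 x) := fun x =>
    tendsto_const_nhds.congr' ((eventually_ge_atTop n).mono fun i hi => by simp [e, hi.not_gt])
  have key : ∀ x ∈ P.dom, ∃ y ∈ Q.dom, ∀ c ∈ Q.sol y, ∃ z ∈ P.sol x, c ∈ D (p, n) ∧
      ∃ r ∈ Ψ (e x) (constSeq c), r 0 = z := by
    intro x hx
    obtain ⟨p', -, hd, hs⟩ := h (e x) ((hP.1 _).2 ⟨he x hx, x, hlim x⟩)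
    obtain ⟨hp', y, hy⟩ := (hQ.1 _).1 hd
    have hyd := mem_dom_of_tendsto hp' hy
    refine ⟨y, hyd, fun c hc => ?_⟩
    rw [hQ.2 _ _ hp' hy, hP.2 _ _ (he x hx) (hlim x)] at hs
    obtain ⟨_, hr, z, hz, rfl⟩ := hs _ ⟨c, hc, rfl⟩
    refine ⟨z, hz, ?_, _, hr, rfl⟩
    obtain ⟨k, hk⟩ := huse _ _ _ hr
    -- Lengthening the segment to `max n k` keeps all decided solutions and decides `c`; by
    -- maximality `c` was decided at `n`.
    refine hmax ⟨(e x, max n k), he x hx, rfl⟩ ?_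
      ⟨Set.mem_biUnion hyd hc, z, fun p' hp' => hk p' fun i hi => hp' i (lt_max_of_lt_right hi)⟩
    rintro c ⟨hcC, z, hz⟩
    refine ⟨hcC, z, fun p' hp' => hz p' fun i hi => ?_⟩
    rw [hp' i (lt_max_of_lt_left hi)]
    exact if_pos hi
  choose! φ hφ hs using key
  refine reducible_of_forall φ (fun c => if hc : c ∈ D (p, n) then hc.2.choose else 0)
    fun x hx => ⟨hφ x hx, fun c hc => ?_⟩
  obtain ⟨z, hz, hcD, r, hr, rfl⟩ := hs x hx c hc
  -- The chosen value would be arbitrary if `Ψ` were undefined throughout; here the actual output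
  -- `r` pins it down.
  rw [dif_pos hcD, ← hcD.2.choose_spec (e x) (fun i hi => if_pos hi) r hr]
  exact hz

/-- Entries of `p.join q` below `k` involve only entries of `p` below `k`, so the use of `Ψ` bounds
the part of the instance consulted. -/
theorem IsJump.reducible_of_w (hP : P.IsJump P') (hQ : Q.IsJump Q') (h : P'.W Q') :
    P.Reducible Q := by
  obtain ⟨Φ, Ψ, -, hΨ, h⟩ := h
  refine hP.reducible_of_witness hQ Φ (fun p q => Ψ (p.join q)) (fun p q r hr => ?_) h
  obtain ⟨k, hk⟩ := hΨ.exists_use hr 0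
  refine ⟨k, fun p' hp' => hk _ fun i hi => ?_⟩
  simp only [Baire.join]
  rw [hp' _ ((Nat.div_le_self i 2).trans_lt hi)]

/-- A strong backward functional does not see the instance, so the empty segment decides everything.
-/
theorem IsJump.reducible_of_contSW (hP : P.IsJump P') (hQ : Q.IsJump Q') (h : P'.ContSW Q') :
    P.Reducible Q := by
  obtain ⟨Φ, Ψ, -, -, h⟩ := h
  exact hP.reducible_of_witness hQ Φ (fun _ => Ψ)
    (fun p q r hr => ⟨0, fun _ _ r' hr' => by rw [Part.mem_unique hr' hr]⟩) h

end FiniteProblem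

/-! ### Pigeonhole and limit problems as jumps -/

/-- Convergence in finite discrete spaces is eventual constancy, which an injective coding preserves
and reflects. -/
theorem codesLimit_iff {m n : ℕ} {p : Baire} {g : Fin m → Fin n} :
    CodesLimit p g ↔ (∀ s, p s ∈ Set.range (funCode (m := m) (n := n))) ∧
      Tendsto p atTop (𝓝 (funCode g)) := by
  constructor
  · rintro ⟨f, hf, hlim⟩
    refine ⟨fun s => ⟨f s, (hf s).symm⟩, ?_⟩
    have : Tendsto f atTop (𝓝 g) := tendsto_pi_nhds.2 hlim
    exact ((continuous_of_discreteTopology (f := funCode (m := m) (n := n))).tendsto g).comp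
      this |>.congr fun s => (hf s).symm
  · rintro ⟨hp, hlim⟩
    choose f hf using hp
    refine ⟨f, fun s => (hf s).symm, fun i => tendsto_const_nhds.congr' ?_⟩
    rw [nhds_discrete, tendsto_pure] at hlim
    filter_upwards [hlim] with s hs
    rw [funCode_injective ((hf s).trans hs)]

theorem wphpJump_isJump (m n : ℕ) (hn : 2 ≤ n) (hm : n < m) :
    (wphp m n hn hm).IsJump (wphpJump m n hn hm) := by
  constructor
  · intro p
    constructor
    · rintro ⟨g, hg⟩
      exact ⟨(codesLimit_iff.1 hg).1, _, (codesLimit_iff.1 hg).2⟩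
    · rintro ⟨hp, x, hx⟩
      obtain ⟨g, rfl⟩ : x ∈ (wphp m n hn hm).dom := FiniteProblem.mem_dom_of_tendsto hp hx
      exact ⟨g, codesLimit_iff.2 ⟨hp, hx⟩⟩
  · intro p x hp hx
    ext q
    constructor
    · rintro ⟨g, hg, c, hc, rfl⟩
      exact ⟨c, ⟨g, tendsto_nhds_unique hx (codesLimit_iff.1 hg).2, hc⟩, rfl⟩
    · rintro ⟨c, ⟨g, rfl, hc⟩, rfl⟩
      exact ⟨g, codesLimit_iff.2 ⟨hp, hx⟩, c, hc, rfl⟩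

/-- The variant of `idProblem` with the instances `0, …, k - 1`. -/
def idBelow (k : ℕ) (hk : 0 < k) : FiniteProblem where
  dom := Set.Iio k
  sol j := {j}
  dom_nonempty := ⟨0, hk⟩
  sol_nonempty j _ := Set.singleton_nonempty j
  dom_finite := Set.finite_Iio k
  sol_finite j _ := Set.finite_singleton j

/-- Needed because `lim_k` uses the values `0, …, k - 1`; a shift by one translates. -/
theorem idBelow_reducible_iff {k : ℕ} (hk : 1 ≤ k) {Q : FiniteProblem} :
    (idBelow k hk).Reducible Q ↔ (idProblem k hk).Reducible Q := by
  constructor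
  · intro h
    obtain ⟨φ, ψ, -, -, h⟩ := h.exists_primrec
    refine FiniteProblem.reducible_of_forall (fun x => φ (x - 1)) (fun y => ψ y + 1) ?_
    rintro x ⟨hx1, hxk⟩
    obtain ⟨hd, hs⟩ := h (x - 1) (show x - 1 < k by omega)
    refine ⟨hd, fun y hy => ?_⟩
    have : ψ y = x - 1 := hs y hy
    exact (show ψ y + 1 = x by omega)
  · intro h
    obtain ⟨φ, ψ, -, -, h⟩ := h.exists_primrec
    refine FiniteProblem.reducible_of_forall (fun x => φ (x + 1)) (fun y => ψ y - 1) ?_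
    intro x (hx : x < k)
    obtain ⟨hd, hs⟩ := h (x + 1) ⟨by omega, hx⟩
    refine ⟨hd, fun y hy => ?_⟩
    have : ψ y = x + 1 := hs y hy
    exact (show ψ y - 1 = x by omega)

theorem limProblem_isJump (k : ℕ) (hk : 2 ≤ k) :
    (idBelow k (one_le_two.trans hk)).IsJump (limProblem k hk) := by
  refine ⟨fun p => Iff.rfl, fun p x _ hx => ?_⟩
  ext q
  constructor
  · rintro ⟨l, hl, rfl⟩
    exact ⟨l, tendsto_nhds_unique hl hx, rfl⟩
  · rintro ⟨l, rfl, rfl⟩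
    exact ⟨_, hx, rfl⟩

theorem theorem3p2 :
    (∀ (k m n : ℕ) (hk : 2 ≤ k) (hn : 2 ≤ n) (hm : n < m),
      List.TFAE [
        (limProblem k hk).W (wphpJump m n hn hm),
        (limProblem k hk).SW (wphpJump m n hn hm),
        (limProblem k hk).ContSW (wphpJump m n hn hm),
        (idProblem k (one_le_two.trans hk)).toBaire.ContSW (wphp m n hn hm).toBaire,
        (idProblem k (one_le_two.trans hk)).Reducible (wphp m n hn hm),
        (idProblem k (one_le_two.trans hk)).toBaire.SW (wphp m n hn hm).toBaire]) ∧
    (∀ (m₀ n₀ m₁ n₁ : ℕ) (hn₀ : 2 ≤ n₀) (hm₀ : n₀ < m₀) (hn₁ : 2 ≤ n₁) (hm₁ : n₁ < m₁),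
      (wphp m₀ n₀ hn₀ hm₀).Reducible (wphp m₁ n₁ hn₁ hm₁) ↔
        (wphpJump m₀ n₀ hn₀ hm₀).W (wphpJump m₁ n₁ hn₁ hm₁)) := by
  refine ⟨fun k m n hk hn hm => ?_, fun m₀ n₀ m₁ n₁ hn₀ hm₀ hn₁ hm₁ => ?_⟩
  · have hP := limProblem_isJump k hk
    have hQ := wphpJump_isJump m n hn hm
    tfae_have 1 → 5 := fun h => (idBelow_reducible_iff _).1 (hP.reducible_of_w hQ h)
    tfae_have 5 → 2 := fun h => hP.sw_of_reducible hQ ((idBelow_reducible_iff _).2 h)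
    tfae_have 2 → 1 := Problem.SW.w
    tfae_have 2 → 3 := Problem.SW.contSW
    tfae_have 3 → 5 := fun h => (idBelow_reducible_iff _).1 (hP.reducible_of_contSW hQ h)
    tfae_have 5 → 6 := FiniteProblem.Reducible.toBaire
    tfae_have 6 → 4 := Problem.SW.contSW
    tfae_have 4 → 5 := FiniteProblem.reducible_of_toBaire
    tfae_finish
  · have hP := wphpJump_isJump m₀ n₀ hn₀ hm₀
    have hQ := wphpJump_isJump m₁ n₁ hn₁ hm₁
    exact ⟨fun h => (hP.sw_of_reducible hQ h).w, hP.reducible_of_w hQ⟩
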